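/- Let $\mathbb D=\{z\in\mathbb C:|z|<1\}$ and let $H^2$ be the classical Hardy space, i.e. the Hilbert space of power series $f(z)=\sum_{n\ge 0}a_nz^n$ with $\sum|a_n|^2<\infty$ and inner product $\langle\sum a_nz^n,\sum b_nz^n\rangle=\sum a_n\overline{b_n}$, viewed as functions on $\mathbb D$; let $k_x$ denote its reproducing kernel at $x\in\mathbb D$, so $\langle f,k_x\rangle=f(x)$. For $A\subset\mathbb D$ let $\mathcal H_A=\overline{\operatorname{span}}\{k_a:a\in A\}\subset H^2$, regarded as a Hilbert function space on $A$ (elements of $\mathcal H_A$ are determined by their restrictions to $A$), let $S(A)=\{x\in\mathbb D:k_x\in\mathcal H_A\}$, and let $\mathcal M_A$ be the multiplier algebra of $\mathcal H_A$: the algebra of all functions $f:A\to\mathbb C$ such that $fh\in\mathcal H_A$ for every $h\in\mathcal H_A$, normed by the operator norm of the multiplication operator $h\mapsto fh$ on $\mathcal H_A$. Let $A,B\subset\mathbb D$ be subsets with $S(A)=A$ and $S(B)=B$. Then: 1. $\mathcal M_A$ and $\mathcal M_B$ are isometrically isomorphic as Banach algebras if and only if $A$ and $B$ are congruent, i.e.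 there is a biholomorphic automorphism $\sigma$ of $\mathbb D$ with $\sigma(A)=B$. 2. If $\Phi:\mathcal M_A\to\mathcal M_B$ is an isometric isomorphism of Banach algebras, then there is a map $\phi:B\to A$, which is the restriction to $B$ of a biholomorphic automorphism of $\mathbb D$, such that $\Phi(f)=f\circ\phi$ for all $f\in\mathcal M_A$. -/

import Mathlib

open scoped Complex.UnitDisc ComplexConjugate Topology

noncomputable section

/-! ### The classical Hardy space as a Hilbert function space on the disk -/

/-- The classical Hardy space `H²`: power series `∑ aₙ zⁿ` with `∑ |aₙ|² < ∞`, with the inner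
product of the coefficient sequences. An element is given by its coefficient sequence; its value
as a function on the disk is the sum of the series (see `HardySpace.instRKHS`). -/
def HardySpace : Type := lp (fun _ : ℕ => ℂ) 2

namespace HardySpace

instance : NormedAddCommGroup HardySpace :=
  inferInstanceAs (NormedAddCommGroup (lp (fun _ : ℕ => ℂ) 2))

instance : InnerProductSpace ℂ HardySpace :=
  inferInstanceAs (InnerProductSpace ℂ (lp (fun _ : ℕ => ℂ) 2))

instance : CompleteSpace HardySpace :=
  inferInstanceAs (CompleteSpace (lp (fun _ : ℕ => ℂ) 2))

/-- The `n`-th Taylor coefficient. -/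
def coeff (f : HardySpace) (n : ℕ) : ℂ := (show lp (fun _ : ℕ => ℂ) 2 from f) n

theorem memℓp_conj_pow (x : 𝔻) : Memℓp (fun n : ℕ => conj (x : ℂ) ^ n) 2 := by
  apply memℓp_gen
  have h : ∀ n : ℕ, ‖conj (x : ℂ) ^ n‖ ^ (2 : ENNReal).toReal = (‖(x : ℂ)‖ ^ 2) ^ n := by
    intro n
    simp [← pow_mul, mul_comm]
  simp_rw [h]
  exact summable_geometric_of_lt_one (by positivity) x.sq_norm_lt_one

/-- The series `∑ conj(x)ⁿ zⁿ`. -/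
def conjPow (x : 𝔻) : HardySpace := ⟨_, memℓp_conj_pow x⟩

theorem hasSum_coeff (f : HardySpace) (x : 𝔻) :
    HasSum (fun n => coeff f n * (x : ℂ) ^ n) (inner ℂ (conjPow x) f) := by
  have h := lp.hasSum_inner (𝕜 := ℂ) (⟨_, memℓp_conj_pow x⟩ : lp (fun _ : ℕ => ℂ) 2) f
  have he : (fun n => coeff f n * (x : ℂ) ^ n) = fun n => inner ℂ
      ((⟨_, memℓp_conj_pow x⟩ : lp (fun _ : ℕ => ℂ) 2) n)
      ((show lp (fun _ : ℕ => ℂ) 2 from f) n) := by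
    funext n
    simp [coeff]
  rw [he]
  exact h

/-- Evaluation `∑ aₙ zⁿ ↦ ∑ aₙ xⁿ` at a point `x` of the disk. -/
def eval (x : 𝔻) : HardySpace →L[ℂ] ℂ where
  toFun f := ∑' n, coeff f n * (x : ℂ) ^ n
  map_add' f g := by
    simp only [(hasSum_coeff _ x).tsum_eq, inner_add_right]
  map_smul' c f := by
    simp only [(hasSum_coeff _ x).tsum_eq, inner_smul_right, RingHom.id_apply, smul_eq_mul]
  cont := by
    simp only [(hasSum_coeff _ x).tsum_eq]
    fun_prop

theorem eq_zero_of_eval (f : HardySpace) (hf : ∀ x, eval x f = 0) : f = 0 := by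
  let p : FormalMultilinearSeries ℂ ℂ ℂ := FormalMultilinearSeries.ofScalars ℂ (coeff f)
  have hp : HasFPowerSeriesAt (0 : ℂ → ℂ) p 0 := by
    rw [hasFPowerSeriesAt_iff]
    filter_upwards [Metric.ball_mem_nhds (0 : ℂ) one_pos] with z hz
    have hz' : ‖z‖ < 1 := by simpa using hz
    have h0 : HasSum (fun n => coeff f n * z ^ n) 0 := by
      have h := (hasSum_coeff f (.mk z hz')).summable.hasSum
      rwa [show (∑' n, coeff f n * ((Complex.UnitDisc.mk z hz' : 𝔻) : ℂ) ^ n) = 0 from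
        hf (.mk z hz')] at h
    simpa [p, mul_comm] using h0
  have hc : ∀ n, coeff f n = 0 := fun n => by
    have := congrArg (fun q : FormalMultilinearSeries ℂ ℂ ℂ => q.coeff n) hp.eq_zero
    have h₀ : (0 : FormalMultilinearSeries ℂ ℂ ℂ).coeff n = 0 := rfl
    simpa [p, h₀] using this
  exact lp.ext (funext hc)

/-- `H²` is a Hilbert function space on the disk. -/
instance instRKHS : RKHS ℂ HardySpace 𝔻 ℂ where
  coeCLM := ContinuousLinearMap.pi eval
  coeCLM_injective := by
    refine (injective_iff_map_eq_zero _).mpr fun f hf => eq_zero_of_eval f fun x => ?_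
    exact congrFun hf x

end HardySpace

/-! ### Subspaces spanned by kernel functions, and multipliers of a Hilbert function space -/

namespace RKHS

section Subspace

variable {X : Type*} (H : Type*) [NormedAddCommGroup H] [InnerProductSpace ℂ H] [CompleteSpace H]
  [RKHS ℂ H X ℂ]

/-- The kernel function `k_x`, so that `⟨f, k_x⟩ = f x`. -/
def kernelAt (x : X) : H := kerFun H x 1

/-- `H_A`, the closed linear span of the kernel functions `k_a`, `a ∈ A`. -/
def subspaceOf (A : Set X) : Submodule ℂ H :=
  (Submodule.span ℂ (kernelAt H '' A)).topologicalClosure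

/-- `S(A) = {x : k_x ∈ H_A}`. -/
def kernelHull (A : Set X) : Set X := {x | kernelAt H x ∈ subspaceOf H A}

instance (A : Set X) : CompleteSpace (subspaceOf H A) :=
  (Submodule.isClosed_topologicalClosure _).completeSpace_coe

theorem eq_zero_of_mem_subspaceOf {A : Set X} {f : H} (hf : f ∈ subspaceOf H A)
    (h0 : ∀ a ∈ A, f a = 0) : f = 0 := by
  have hle : subspaceOf H A ≤ (Submodule.span ℂ {f})ᗮ := by
    refine Submodule.topologicalClosure_minimal _ ?_ (Submodule.isClosed_orthogonal _)
    rw [Submodule.span_le]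
    rintro _ ⟨a, ha, rfl⟩
    simp [Submodule.mem_orthogonal_singleton_iff_inner_right, kernelAt, h0 a ha]
  have := Submodule.mem_orthogonal_singleton_iff_inner_right.mp (hle hf)
  exact inner_self_eq_zero.mp this

/-- `H_A` is a Hilbert function space on `A`, its elements being restricted to `A`. -/
instance instSubspaceOf (A : Set X) : RKHS ℂ (subspaceOf H A) A ℂ where
  coeCLM := ContinuousLinearMap.pi fun a : A =>
    (ContinuousLinearMap.proj (a : X)).comp ((coeCLM ℂ).comp (subspaceOf H A).subtypeL)
  coeCLM_injective := by
    refine (injective_iff_map_eq_zero _).mpr fun f hf => Subtype.ext ?_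
    exact eq_zero_of_mem_subspaceOf H f.2 fun a ha => congrFun hf ⟨a, ha⟩

end Subspace

section Multiplier

variable {X : Type*} (H : Type*) [NormedAddCommGroup H] [InnerProductSpace ℂ H] [RKHS ℂ H X ℂ]

/-- The multiplier algebra `M(H)`: all functions `f` on `X` with `f h ∈ H` for every `h ∈ H`. -/
def multiplierAlgebra : Subalgebra ℂ (X → ℂ) where
  carrier := {f | ∀ h : H, ∃ g : H, ∀ x, g x = f x * h x}
  mul_mem' := by
    intro f₁ f₂ h₁ h₂ h
    obtain ⟨g, hg⟩ := h₂ h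
    obtain ⟨g', hg'⟩ := h₁ g
    exact ⟨g', fun x => by rw [hg', hg, Pi.mul_apply, mul_assoc]⟩
  add_mem' := by
    intro f₁ f₂ h₁ h₂ h
    obtain ⟨g₁, hg₁⟩ := h₁ h
    obtain ⟨g₂, hg₂⟩ := h₂ h
    exact ⟨g₁ + g₂, fun x => by simp [hg₁, hg₂, add_mul]⟩
  algebraMap_mem' := by
    intro c h
    exact ⟨c • h, fun x => by simp⟩

variable {H}

/-- The multiplication operator `M_f h = f h` of a multiplier `f`, as a linear map. -/
def mulLinearMap (f : multiplierAlgebra H) : H →ₗ[ℂ] H where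
  toFun h := (f.2 h).choose
  map_add' h₁ h₂ := RKHS.ext fun x => by
    rw [(f.2 (h₁ + h₂)).choose_spec, coe_add, coe_add, Pi.add_apply, Pi.add_apply,
      (f.2 h₁).choose_spec, (f.2 h₂).choose_spec, mul_add]
  map_smul' c h := RKHS.ext fun x => by
    rw [(f.2 (c • h)).choose_spec, coe_smul, RingHom.id_apply, coe_smul, Pi.smul_apply,
      Pi.smul_apply, (f.2 h).choose_spec, smul_eq_mul, smul_eq_mul, mul_left_comm]

theorem mulLinearMap_apply (f : multiplierAlgebra H) (h : H) (x : X) :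
    mulLinearMap f h x = (f : X → ℂ) x * h x :=
  (f.2 h).choose_spec x

/-- The bounded multiplication operator `M_f h = f h` of a multiplier `f`. -/
def mulOp [CompleteSpace H] (f : multiplierAlgebra H) : H →L[ℂ] H where
  toLinearMap := mulLinearMap f
  cont := by
    refine (mulLinearMap f).continuous_of_seq_closed_graph fun u h g hu hg => RKHS.ext fun x => ?_
    have h₁ := ((continuous_eval x).tendsto g).comp hg
    have h₂ := (((continuous_eval x).tendsto h).comp hu).const_mul ((f : X → ℂ) x)
    rw [mulLinearMap_apply]
    refine tendsto_nhds_unique h₁ (h₂.congr fun n => ?_)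
    simp [mulLinearMap_apply]

/-- The norm of the Banach algebra `M(H)`: the operator norm of `M_f`. -/
def multiplierNorm [CompleteSpace H] (f : multiplierAlgebra H) : ℝ := ‖mulOp f‖

end Multiplier

end RKHS

/-! ### Automorphisms of the disk and the algebras `M_A` -/

namespace HardySpace

/-- `M_A = M(H_A)`, an algebra of functions on `A`. -/
abbrev multipliers (A : Set 𝔻) : Subalgebra ℂ (A → ℂ) :=
  RKHS.multiplierAlgebra (RKHS.subspaceOf HardySpace A)

/-- `Φ` is isometric for the multiplier norms; an algebra isomorphism `M_A ≃ₐ M_B` with this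
property is an isometric isomorphism of Banach algebras. -/
def IsIsometric {A B : Set 𝔻} (Φ : multipliers A ≃ₐ[ℂ] multipliers B) : Prop :=
  ∀ f, RKHS.multiplierNorm (Φ f) = RKHS.multiplierNorm f

/-- `Φ` is the pull-back `f ↦ f ∘ φ` by `φ : B → A`. -/
def IsPullback {A B : Set 𝔻} (Φ : multipliers A ≃ₐ[ℂ] multipliers B) (φ : B → A) : Prop :=
  ∀ f, (Φ f : B → ℂ) = (f : A → ℂ) ∘ φ

/-- Holomorphic self-maps of the disk. -/
def HolomorphicSelfMap (φ : 𝔻 → 𝔻) : Prop :=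
  ∃ g : ℂ → ℂ, DifferentiableOn ℂ g (Metric.ball 0 1) ∧ ∀ z : 𝔻, g z = φ z

/-- Bi-holomorphic automorphisms of the disk. -/
def IsDiskAutomorphism (σ : 𝔻 ≃ 𝔻) : Prop :=
  HolomorphicSelfMap σ ∧ HolomorphicSelfMap σ.symm

/-- Two subsets of the disk are congruent if some automorphism of the disk takes one to the
other. -/
def Congruent (A B : Set 𝔻) : Prop := ∃ σ : 𝔻 ≃ 𝔻, IsDiskAutomorphism σ ∧ σ '' A = B

end HardySpace

end

/-! ### Contractions determined by a spanning family -/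

section Contraction

variable {ι E F : Type*} [NormedAddCommGroup E] [InnerProductSpace ℂ E]
  [NormedAddCommGroup F] [InnerProductSpace ℂ F]

/-! Everything about multipliers is read off kernel functions: `M_f` has norm at most `C` exactly
when `k_x ↦ conj (f x) k_x` is bounded by `C` on their span. For the converse half of the
equivalence, a disk automorphism rescales the Szegő kernel, so composing with it preserves
multiplier norms.

For the other half, the engine is the Pick property of the Szegő kernel: contractive multipliers of
`H_A` extend to contractive multipliers of `H²` (`exists_extension_of_norm_le_one`, by the lurking
isometry argument). Given an isometric `Φ`, extend the image of the coordinate function to such an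
`F`. The maximum principle makes `F` a self-map of the disk. Dividing by `z - l` among multipliers
shows that `Φ` followed by evaluation at `b` is evaluation at `F b`, and `S(A) = A` puts `F b` in
`A`, since otherwise a multiplier vanishing on `A` would not vanish there.

The same for `Φ⁻¹` gives a self-map `G` inverse to `F` between `B` and `A`. If `B` has two points,
`G ∘ F` fixes both and is the identity by the Schwarz lemma, so `F` is an automorphism; for smaller
`B` an automorphism is chosen by hand. -/

/-- A family bounded by another one, in the sense of linear combinations, is its image under a
bounded operator. -/
theorem exists_clm_of_norm_sum_le [CompleteSpace E] [CompleteSpace F] {u : ι → E} {v : ι → F}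
    {C : ℝ} (hC : 0 ≤ C)
    (h : ∀ (s : Finset ι) (a : ι → ℂ), ‖∑ i ∈ s, a i • v i‖ ≤ C * ‖∑ i ∈ s, a i • u i‖) :
    ∃ T : E →L[ℂ] F, ‖T‖ ≤ C ∧ ∀ i, T (u i) = v i := by
  let e₀ : (ι →₀ ℂ) →ₗ[ℂ] E := Finsupp.linearCombination ℂ u
  let K : Submodule ℂ E := (LinearMap.range e₀).topologicalClosure
  have : CompleteSpace K := (Submodule.isClosed_topologicalClosure _).completeSpace_coe
  let e : (ι →₀ ℂ) →ₗ[ℂ] K :=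
    e₀.codRestrict K fun c => Submodule.le_topologicalClosure _ (LinearMap.mem_range_self _ c)
  let g : (ι →₀ ℂ) →ₗ[ℂ] F := Finsupp.linearCombination ℂ v
  have hd : DenseRange e := by
    intro x
    rw [closure_subtype]
    have hr : Subtype.val '' Set.range e = (LinearMap.range e₀ : Set E) := by
      ext y
      simp [e]
    rw [hr]
    exact x.2
  have hn : ∀ c, ‖g c‖ ≤ C * ‖e c‖ := fun c => by
    simpa [g, e, e₀, Finsupp.linearCombination_apply, Finsupp.sum] using h c.support c
  -- Extending by zero on the orthogonal complement of the span keeps the bound `C`.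
  refine ⟨(g.extendOfNorm e).comp K.orthogonalProjectionOnto, ?_, fun i => ?_⟩
  · refine (ContinuousLinearMap.opNorm_comp_le _ _).trans ?_
    exact (mul_le_mul (LinearMap.opNorm_extendOfNorm_le hd hC hn)
      K.orthogonalProjectionOnto_norm_le (ContinuousLinearMap.opNorm_nonneg _) hC).trans (mul_one C).le
  · have hu : u i = (e (Finsupp.single i 1) : E) := by simp [e, e₀]
    rw [ContinuousLinearMap.comp_apply, hu, Submodule.orthogonalProjectionOnto_mem_subspace_eq_self,
      LinearMap.extendOfNorm_eq hd ⟨C, hn⟩]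
    simp [g]

/-- Families with the same Gram matrix have linear combinations of the same norm. -/
theorem norm_sum_eq_of_inner_eq {u : ι → E} {v : ι → F}
    (h : ∀ i j, inner ℂ (u i) (u j) = inner ℂ (v i) (v j)) (s : Finset ι) (a : ι → ℂ) :
    ‖∑ i ∈ s, a i • u i‖ = ‖∑ i ∈ s, a i • v i‖ := by
  have : inner ℂ (∑ i ∈ s, a i • u i) (∑ i ∈ s, a i • u i) =
      inner ℂ (∑ i ∈ s, a i • v i) (∑ i ∈ s, a i • v i) := by
    simp only [sum_inner, inner_sum, inner_smul_left, inner_smul_right, h]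
  rw [inner_self_eq_norm_sq_to_K, inner_self_eq_norm_sq_to_K] at this
  exact (sq_eq_sq₀ (norm_nonneg _) (norm_nonneg _)).mp (by exact_mod_cast this)

theorem norm_sq_sum_smul_toLp (p : ι → ℂ) (q : ι → E) (s : Finset ι) (a : ι → ℂ) :
    ‖∑ i ∈ s, a i • WithLp.toLp 2 (p i, q i)‖ ^ 2 =
      ‖∑ i ∈ s, a i * p i‖ ^ 2 + ‖∑ i ∈ s, a i • q i‖ ^ 2 := by
  have : ∑ i ∈ s, a i • WithLp.toLp 2 (p i, q i) =
      WithLp.toLp 2 (∑ i ∈ s, a i * p i, ∑ i ∈ s, a i • q i) := by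
    rw [prod_mk_sum, WithLp.toLp_sum]
    rfl
  rw [this, WithLp.prod_norm_sq_eq_of_L2]
  rfl

/-- The defect operator of a contraction. -/
theorem exists_inner_map_map_eq_sub [CompleteSpace E] {M : E →L[ℂ] E} (hM : ‖M‖ ≤ 1) :
    ∃ S : E →L[ℂ] E, ∀ x y, inner ℂ (S x) (S y) =
      inner ℂ x y - inner ℂ (M.adjoint x) (M.adjoint y) := by
  have hpos : 0 ≤ 1 - M * star M := by
    rw [sub_nonneg, ← CStarAlgebra.norm_le_one_iff_of_nonneg _ (mul_star_self_nonneg M),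
      CStarRing.norm_self_mul_star]
    exact mul_le_one₀ hM (norm_nonneg _) hM
  -- The square root of `1 - M M*`, which is positive because `M` is a contraction.
  set S : E →L[ℂ] E := CFC.sqrt (1 - M * star M)
  have hS : S * S = 1 - M * star M := CFC.sqrt_mul_sqrt_self _ hpos
  have hSa : star S = S := (CFC.sqrt_nonneg (1 - M * star M)).isSelfAdjoint.star_eq
  refine ⟨S, fun x y => ?_⟩
  have e1 : inner ℂ (S x) (S y) = inner ℂ x ((S * S) y) := by
    rw [← ContinuousLinearMap.adjoint_inner_right, ← ContinuousLinearMap.star_eq_adjoint, hSa]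
    rfl
  have e2 : (M * star M) y = M (M.adjoint y) := rfl
  rw [e1, hS, sub_apply, inner_sub_right, e2, one_apply_eq_self,
    ContinuousLinearMap.adjoint_inner_left M]

end Contraction

/-! ### Multipliers and kernel functions -/

namespace RKHS

section Multiplier

variable {X : Type*} {H : Type*} [NormedAddCommGroup H] [InnerProductSpace ℂ H] [CompleteSpace H]
  [RKHS ℂ H X ℂ]

theorem inner_kernelAt (x : X) (f : H) : inner ℂ (kernelAt H x) f = f x := by
  simp [kernelAt]

theorem mulOp_apply (f : multiplierAlgebra H) (h : H) (x : X) :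
    mulOp f h x = (f : X → ℂ) x * h x :=
  mulLinearMap_apply f h x

/-- Kernel functions are eigenvectors of `M_f*`; this turns multiplier norms into inequalities
between linear combinations of kernels. -/
theorem adjoint_mulOp_kernelAt (f : multiplierAlgebra H) (x : X) :
    (mulOp f).adjoint (kernelAt H x) = conj ((f : X → ℂ) x) • kernelAt H x := by
  refine ext_inner_right ℂ fun h => ?_
  rw [ContinuousLinearMap.adjoint_inner_left, inner_smul_left, inner_kernelAt, inner_kernelAt,
    mulOp_apply, Complex.conj_conj]

theorem norm_sum_conj_smul_kernelAt_le {ι : Type*} (f : multiplierAlgebra H) (p : ι → X)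
    (s : Finset ι) (a : ι → ℂ) :
    ‖∑ i ∈ s, a i • conj ((f : X → ℂ) (p i)) • kernelAt H (p i)‖ ≤
      multiplierNorm f * ‖∑ i ∈ s, a i • kernelAt H (p i)‖ := by
  have : ∑ i ∈ s, a i • conj ((f : X → ℂ) (p i)) • kernelAt H (p i) =
      (mulOp f).adjoint (∑ i ∈ s, a i • kernelAt H (p i)) := by
    simp [map_sum, adjoint_mulOp_kernelAt]
  rw [this]
  refine ((mulOp f).adjoint.le_opNorm _).trans_eq ?_
  rw [LinearIsometryEquiv.norm_map]
  rfl

/-- A function is a multiplier of norm at most `C` as soon as its conjugate acts diagonally on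
the kernel functions with norm at most `C`. -/
theorem exists_mem_multiplierAlgebra {f : X → ℂ} {C : ℝ} (hC : 0 ≤ C)
    (h : ∀ (s : Finset X) (a : X → ℂ), ‖∑ x ∈ s, a x • conj (f x) • kernelAt H x‖ ≤
      C * ‖∑ x ∈ s, a x • kernelAt H x‖) :
    ∃ hf : f ∈ multiplierAlgebra H, multiplierNorm ⟨f, hf⟩ ≤ C := by
  obtain ⟨T, hT, hTk⟩ := exists_clm_of_norm_sum_le hC h
  have hv : ∀ (g : H) (x : X), T.adjoint g x = f x * g x := fun g x => by
    rw [← inner_kernelAt x (T.adjoint g), ContinuousLinearMap.adjoint_inner_right, hTk,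
      inner_smul_left, inner_kernelAt, Complex.conj_conj]
  have hf : f ∈ multiplierAlgebra H := fun g => ⟨T.adjoint g, hv g⟩
  refine ⟨hf, ?_⟩
  have : mulOp ⟨f, hf⟩ = T.adjoint := by
    ext g x
    rw [mulOp_apply, hv]
  rw [multiplierNorm, this, LinearIsometryEquiv.norm_map]
  exact hT

theorem kernelAt_ne_zero {f : H} {x : X} (hf : f x ≠ 0) : kernelAt H x ≠ 0 := by
  intro h
  apply hf
  rw [← inner_kernelAt, h, inner_zero_left]

theorem norm_le_multiplierNorm (f : multiplierAlgebra H) {x : X} (hx : kernelAt H x ≠ 0) :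
    ‖(f : X → ℂ) x‖ ≤ multiplierNorm f := by
  have := norm_sum_conj_smul_kernelAt_le f id {x} 1
  simp only [Finset.sum_singleton, id, Pi.one_apply, one_smul, norm_smul, RCLike.norm_conj] at this
  exact le_of_mul_le_mul_right this (norm_pos_iff.mpr hx)

theorem multiplierNorm_nonneg (f : multiplierAlgebra H) : 0 ≤ multiplierNorm f := norm_nonneg _

theorem multiplierNorm_smul_le (c : ℂ) (f : multiplierAlgebra H) :
    multiplierNorm (c • f) ≤ ‖c‖ * multiplierNorm f := by
  have : mulOp (c • f) = c • mulOp f := by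
    ext g x
    simp [mulOp_apply, mul_assoc]
  rw [multiplierNorm, this, norm_smul]
  rfl

end Multiplier

section Subspace

variable {X : Type*} {H : Type*} [NormedAddCommGroup H] [InnerProductSpace ℂ H] [CompleteSpace H]
  [RKHS ℂ H X ℂ] {A : Set X}

theorem kernelAt_mem_subspaceOf {a : X} (ha : a ∈ A) : kernelAt H a ∈ subspaceOf H A :=
  Submodule.le_topologicalClosure _ (Submodule.subset_span ⟨a, ha, rfl⟩)

theorem subspaceOf_apply (h : subspaceOf H A) (a : A) : h a = (h : H) a := rfl

theorem coe_kernelAt_subspaceOf (a : A) :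
    (kernelAt (subspaceOf H A) a : H) = kernelAt H (a : X) := by
  have : kernelAt (subspaceOf H A) a = ⟨kernelAt H (a : X), kernelAt_mem_subspaceOf a.2⟩ := by
    refine ext_inner_right ℂ fun h => ?_
    rw [inner_kernelAt, Submodule.coe_inner, inner_kernelAt, subspaceOf_apply]
  rw [this]

theorem norm_sum_smul_kernelAt_subspaceOf {ι : Type*} (p : ι → A) (s : Finset ι) (a : ι → ℂ) :
    ‖∑ i ∈ s, a i • kernelAt (subspaceOf H A) (p i)‖ =
      ‖∑ i ∈ s, a i • kernelAt H (p i : X)‖ := by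
  rw [Submodule.coe_norm]
  simp [coe_kernelAt_subspaceOf]

/-- Multipliers restrict to the subspaces spanned by kernel functions. -/
theorem exists_restrict_mem_multiplierAlgebra (A : Set X) (F : multiplierAlgebra H) :
    ∃ hf : (fun a : A => (F : X → ℂ) a) ∈ multiplierAlgebra (subspaceOf H A),
      multiplierNorm ⟨_, hf⟩ ≤ multiplierNorm F := by
  refine exists_mem_multiplierAlgebra (multiplierNorm_nonneg F) fun s a => ?_
  simp only [smul_smul]
  rw [norm_sum_smul_kernelAt_subspaceOf fun x => x, norm_sum_smul_kernelAt_subspaceOf fun x => x]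
  simpa only [smul_smul] using norm_sum_conj_smul_kernelAt_le F (fun x : A => (x : X)) s a

end Subspace

end RKHS

/-! ### The Szegő kernel and the coordinate multiplier -/

namespace HardySpace

open RKHS

theorem kernelAt_eq_conjPow (x : 𝔻) : kernelAt HardySpace x = conjPow x := by
  refine ext_inner_right ℂ fun f => ?_
  rw [inner_kernelAt, ← (hasSum_coeff f x).tsum_eq]
  rfl

theorem one_sub_mul_conj_ne_zero (z w : 𝔻) : (1 - z * conj (w : ℂ) : ℂ) ≠ 0 := by
  intro h
  have h1 : (z * conj (w : ℂ) : ℂ) = 1 := (sub_eq_zero.mp h).symm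
  have h2 : ‖(z : ℂ)‖ * ‖(w : ℂ)‖ = 1 := by
    simpa using congrArg norm h1
  nlinarith [z.norm_lt_one, w.norm_lt_one, norm_nonneg (z : ℂ), norm_nonneg (w : ℂ)]

theorem kernelAt_apply (w z : 𝔻) :
    kernelAt HardySpace w z = (1 - z * conj (w : ℂ))⁻¹ := by
  have h : HasSum (fun n => ((z : ℂ) * conj (w : ℂ)) ^ n) (kernelAt HardySpace w z) := by
    rw [← inner_kernelAt z, kernelAt_eq_conjPow, kernelAt_eq_conjPow]
    convert hasSum_coeff (conjPow w) z using 2 with n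
    rw [mul_pow, mul_comm]
    rfl
  refine h.unique (hasSum_geometric_of_norm_lt_one ?_)
  rw [norm_mul, RCLike.norm_conj]
  nlinarith [z.norm_lt_one, w.norm_lt_one, norm_nonneg (z : ℂ), norm_nonneg (w : ℂ)]

theorem inner_kernelAt_kernelAt (z w : 𝔻) :
    inner ℂ (kernelAt HardySpace z) (kernelAt HardySpace w) = (1 - z * conj (w : ℂ))⁻¹ := by
  rw [inner_kernelAt, kernelAt_apply]

theorem kernelAt_zero_apply (z : 𝔻) : kernelAt HardySpace 0 z = 1 := by
  simp [kernelAt_apply]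

theorem kernelAt_ne_zero (x : 𝔻) : kernelAt HardySpace x ≠ 0 :=
  RKHS.kernelAt_ne_zero (f := kernelAt HardySpace 0) (by simp [kernelAt_zero_apply])

/-- The Szegő kernel satisfies `k = 1 + z w̄ k`, so the families `k_z` and `(1, z̄ k_z)` have the
same Gram matrix. -/
theorem norm_sq_sum_kernelAt (s : Finset 𝔻) (a : 𝔻 → ℂ) :
    ‖∑ x ∈ s, a x • kernelAt HardySpace x‖ ^ 2 =
      ‖∑ x ∈ s, a x‖ ^ 2 + ‖∑ x ∈ s, (a x * conj (x : ℂ)) • kernelAt HardySpace x‖ ^ 2 := by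
  have h := norm_sum_eq_of_inner_eq (u := fun x : 𝔻 => kernelAt HardySpace x)
    (v := fun x : 𝔻 => WithLp.toLp 2 ((1 : ℂ), conj (x : ℂ) • kernelAt HardySpace x))
    (fun z w => by
      have := one_sub_mul_conj_ne_zero z w
      simp only [WithLp.prod_inner_apply, inner_smul_left, inner_smul_right,
        inner_kernelAt_kernelAt]
      simp
      field_simp
      ring) s a
  rw [h, norm_sq_sum_smul_toLp]
  simp [smul_smul]

theorem exists_coe_mem_multiplierAlgebra :
    ∃ h : (fun x : 𝔻 => (x : ℂ)) ∈ multiplierAlgebra HardySpace, multiplierNorm ⟨_, h⟩ ≤ 1 := by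
  refine exists_mem_multiplierAlgebra zero_le_one fun s a => ?_
  have := norm_sq_sum_kernelAt s a
  rw [one_mul]
  refine (sq_le_sq₀ (norm_nonneg _) (norm_nonneg _)).mp ?_
  simp only [smul_smul]
  nlinarith [sq_nonneg ‖∑ x ∈ s, a x‖]

/-- The coordinate function as a multiplier of `H²`. -/
noncomputable def coord : multiplierAlgebra HardySpace := ⟨_, exists_coe_mem_multiplierAlgebra.1⟩

theorem coord_apply (x : 𝔻) : (coord : 𝔻 → ℂ) x = x := rfl

theorem multiplierNorm_coord_le : multiplierNorm coord ≤ 1 := exists_coe_mem_multiplierAlgebra.2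

/-- The adjoint of multiplication by `z` is the backward shift, because `x̄ M_z k_x = k_x - k_0`. -/
theorem coord_mul_adjoint_apply (f : HardySpace) (x : 𝔻) :
    (x : ℂ) * (mulOp coord).adjoint f x = f x - f 0 := by
  rw [← coord_apply, ← mulOp_apply, ← inner_kernelAt x, ← ContinuousLinearMap.adjoint_inner_left,
    ContinuousLinearMap.adjoint_inner_right, adjoint_mulOp_kernelAt, coord_apply, map_smul,
    inner_smul_left]
  have : conj (x : ℂ) • mulOp coord (kernelAt HardySpace x) =
      kernelAt HardySpace x - kernelAt HardySpace 0 := by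
    ext z
    simp only [coe_smul, coe_sub, Pi.smul_apply, Pi.sub_apply, smul_eq_mul, mulOp_apply,
      coord_apply, kernelAt_zero_apply]
    rw [kernelAt_apply]
    linear_combination -mul_inv_cancel₀ (one_sub_mul_conj_ne_zero z x)
  rw [← inner_smul_left, this, inner_sub_left, inner_kernelAt, inner_kernelAt]

theorem isUnit_one_sub_smul {E : Type*} [NormedAddCommGroup E] [NormedSpace ℂ E] [CompleteSpace E]
    {T : E →L[ℂ] E} (hT : ‖T‖ ≤ 1) {c : ℂ} (hc : ‖c‖ < 1) : IsUnit (1 - c • T) := by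
  refine isUnit_one_sub_of_norm_lt_one ?_
  rw [norm_smul]
  nlinarith [norm_nonneg c, norm_nonneg T]

/-- Division by `z - l` in `H²`. -/
theorem exists_sub_mul_eq_sub (f : HardySpace) (l : 𝔻) :
    ∃ g : HardySpace, ∀ x : 𝔻, ((x : ℂ) - l) * g x = f x - f l := by
  set B := (mulOp coord).adjoint with hB
  have hn : ‖B‖ ≤ 1 := by
    rw [hB, LinearIsometryEquiv.norm_map]
    exact multiplierNorm_coord_le
  obtain ⟨u, hu⟩ := isUnit_one_sub_smul hn l.norm_lt_one
  -- Formally `(f - f l) / (z - l) = (1 - l B)⁻¹ B f` with `B` the backward shift. Multiplying by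
  -- `z` gives the claim up to a constant, which evaluation at `l` then identifies.
  obtain ⟨g, hg⟩ : ∃ g, g - (l : ℂ) • B g = B f := by
    refine ⟨(↑u⁻¹ : HardySpace →L[ℂ] HardySpace) (B f), ?_⟩
    have := congrArg (fun T : HardySpace →L[ℂ] HardySpace => T (B f)) u.mul_inv
    simpa [hu] using this
  have h1 : ∀ x : 𝔻, ((x : ℂ) - l) * g x = f x - f 0 - l * g 0 := fun x => by
    have e1 := coord_mul_adjoint_apply f x
    have e2 := coord_mul_adjoint_apply g x
    have e3 : g x - l * B g x = B f x := by
      rw [← hg]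
      simp
    linear_combination e1 + l * e2 + x * e3
  refine ⟨g, fun x => ?_⟩
  have h2 := h1 l
  rw [sub_self, zero_mul] at h2
  linear_combination h1 x - h2

/-! ### Holomorphy -/

theorem exists_differentiableOn (f : HardySpace) :
    ∃ g : ℂ → ℂ, DifferentiableOn ℂ g (Metric.ball 0 1) ∧ ∀ z : 𝔻, g z = f z := by
  let p : FormalMultilinearSeries ℂ ℂ ℂ := FormalMultilinearSeries.ofScalars ℂ (coeff f)
  have hp : (1 : ENNReal) ≤ p.radius := by
    refine ENNReal.le_of_forall_nnreal_lt fun r hr => ?_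
    have hr' : ‖((r : ℝ) : ℂ)‖ < 1 := by
      simpa using hr
    have hs := (hasSum_coeff f (.mk _ hr')).summable
    refine p.le_radius_of_tendsto (l := 0) ?_
    have := hs.tendsto_atTop_zero.norm
    simpa [p] using this
  have hf : HasFPowerSeriesOnBall p.sum p 0 1 :=
    (p.hasFPowerSeriesOnBall (lt_of_lt_of_le one_pos hp)).mono one_pos hp
  refine ⟨p.sum, ?_, fun z => ?_⟩
  · have := hf.differentiableOn
    rwa [← ENNReal.coe_one, Metric.eball_coe] at this
  · simp only [p, FormalMultilinearSeries.sum, FormalMultilinearSeries.ofScalars_apply_eq]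
    simp
    rfl

theorem exists_differentiableOn_multiplier (F : multiplierAlgebra HardySpace) :
    ∃ g : ℂ → ℂ, DifferentiableOn ℂ g (Metric.ball 0 1) ∧ ∀ z : 𝔻, g z = (F : 𝔻 → ℂ) z := by
  obtain ⟨g, hg, hgf⟩ := exists_differentiableOn (mulOp F (kernelAt HardySpace 0))
  exact ⟨g, hg, fun z => by rw [hgf, mulOp_apply, kernelAt_zero_apply, mul_one]⟩

end HardySpace

/-! ### Extension of multipliers to the disk -/

namespace HardySpace

open RKHS

/-- A solution of `T (1, z̄ h_z) = (conj (F z), h_z)` with a contraction `T` makes `F` a contractive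
multiplier. -/
theorem exists_mem_multiplierAlgebra_of_contraction {E : Type*} [NormedAddCommGroup E]
    [InnerProductSpace ℂ E] {T : WithLp 2 (ℂ × E) →L[ℂ] WithLp 2 (ℂ × E)} (hT : ‖T‖ ≤ 1)
    {F : 𝔻 → ℂ} {h : 𝔻 → E}
    (hTh : ∀ z : 𝔻, T (WithLp.toLp 2 (1, conj (z : ℂ) • h z)) = WithLp.toLp 2 (conj (F z), h z)) :
    ∃ hF : F ∈ multiplierAlgebra HardySpace, multiplierNorm ⟨F, hF⟩ ≤ 1 := by
  refine exists_mem_multiplierAlgebra zero_le_one fun s a => ?_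
  have hstep : ∀ b : 𝔻 → ℂ, ‖∑ z ∈ s, b z * conj (F z)‖ ^ 2 + ‖∑ z ∈ s, b z • h z‖ ^ 2 ≤
      ‖∑ z ∈ s, b z‖ ^ 2 + ‖∑ z ∈ s, (b z * conj (z : ℂ)) • h z‖ ^ 2 := fun b => by
    have h1 := norm_sq_sum_smul_toLp (fun z => conj (F z)) h s b
    have h2 := norm_sq_sum_smul_toLp (fun _ => 1) (fun z : 𝔻 => conj (z : ℂ) • h z) s b
    simp only [mul_one, smul_smul] at h2
    rw [← h1, ← h2]
    have h3 := T.le_of_opNorm_le hT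
      (∑ z ∈ s, b z • WithLp.toLp 2 ((1 : ℂ), (conj (z : ℂ)) • h z))
    simp only [map_sum, map_smul, hTh, one_mul] at h3
    gcongr
  -- The contraction gives `R b ≤ R (z̄ b)`. Iterating, `R a ≤ R (z̄ⁿ a) → 0`, so `R a ≤ 0`, which
  -- is stronger than the bound sought.
  let R : (𝔻 → ℂ) → ℝ := fun b =>
    ‖∑ z ∈ s, (b z * conj (F z)) • kernelAt HardySpace z‖ ^ 2 -
      ‖∑ z ∈ s, b z • kernelAt HardySpace z‖ ^ 2 + ‖∑ z ∈ s, b z • h z‖ ^ 2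
  have hR : ∀ b, R b ≤ R fun z => b z * conj (z : ℂ) := fun b => by
    have h1 := norm_sq_sum_kernelAt s b
    have h2 := norm_sq_sum_kernelAt s fun z => b z * conj (F z)
    have h3 := hstep b
    simp only [R, mul_right_comm _ (conj _) (conj (F _))] at h2 ⊢
    simp only [mul_right_comm _ (conj (F _)) (conj _)] at h2 ⊢
    linarith
  have hRn : ∀ n : ℕ, R a ≤ R fun z => a z * conj (z : ℂ) ^ n := fun n => by
    induction n with
    | zero => simp
    | succ n ih => simpa only [pow_succ, mul_assoc] using ih.trans (hR _)
  have hp : ∀ z : 𝔻, Filter.Tendsto (fun n : ℕ => a z * conj (z : ℂ) ^ n) Filter.atTop (𝓝 0) :=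
    fun z => by
      simpa using (tendsto_pow_atTop_nhds_zero_of_norm_lt_one
        (x := conj (z : ℂ)) (by simpa using z.norm_lt_one)).const_mul (a z)
  have hsum : ∀ v : 𝔻 → HardySpace,
      Filter.Tendsto (fun n : ℕ => ‖∑ z ∈ s, (a z * conj (z : ℂ) ^ n) • v z‖ ^ 2)
        Filter.atTop (𝓝 0) := fun v => by
    have := tendsto_finsetSum s fun z _ => (hp z).smul_const (v z)
    simpa using (this.norm.pow 2)
  have hlim : Filter.Tendsto (fun n : ℕ => R fun z => a z * conj (z : ℂ) ^ n)
      Filter.atTop (𝓝 0) := by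
    have h1 := hsum fun z => conj (F z) • kernelAt HardySpace z
    have h2 := hsum fun z => kernelAt HardySpace z
    have h3 : Filter.Tendsto (fun n : ℕ => ‖∑ z ∈ s, (a z * conj (z : ℂ) ^ n) • h z‖ ^ 2)
        Filter.atTop (𝓝 0) := by
      have := tendsto_finsetSum s fun z _ => (hp z).smul_const (h z)
      simpa using (this.norm.pow 2)
    simpa [R, smul_smul] using (h1.sub h2).add h3
  have h0 : R a ≤ 0 := ge_of_tendsto' hlim hRn
  rw [one_mul]
  refine (sq_le_sq₀ (norm_nonneg _) (norm_nonneg _)).mp ?_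
  simp only [smul_smul]
  have := sq_nonneg ‖∑ z ∈ s, a z • h z‖
  simp only [R] at h0
  linarith

/-- A contraction `T` on `ℂ ⊕ E` determines a solution of `T (1, z̄ h_z) = (conj (F z), h_z)`. -/
theorem exists_colligation_solution {E : Type*} [NormedAddCommGroup E]
    [InnerProductSpace ℂ E] [CompleteSpace E] {T : WithLp 2 (ℂ × E) →L[ℂ] WithLp 2 (ℂ × E)}
    (hT : ‖T‖ ≤ 1) (z : 𝔻) :
    ∃ (w : ℂ) (h : E), T (WithLp.toLp 2 (1, conj (z : ℂ) • h)) = WithLp.toLp 2 (conj w, h) ∧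
      ∀ (w' : ℂ) (h' : E),
        T (WithLp.toLp 2 (1, conj (z : ℂ) • h')) = WithLp.toLp 2 (conj w', h') → w' = w := by
  -- With `c` and `D` the blocks of `T` from `ℂ` and from `E` into `E`, the second component of the
  -- equation reads `h = c + z̄ D h`. As `‖D‖ ≤ 1` and `|z| < 1`, it has the unique solution `(1 -
  -- z̄ D)⁻¹ c`; the first component then fixes `w`.
  let D₀ : E →ₗ[ℂ] E :=
    { toFun := fun y => (T (WithLp.toLp 2 (0, y))).snd
      map_add' := fun x y => by
        rw [← WithLp.add_snd, ← map_add, ← WithLp.toLp_add, Prod.mk_add_mk, add_zero]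
      map_smul' := fun c x => by
        rw [RingHom.id_apply, ← WithLp.smul_snd, ← map_smul, ← WithLp.toLp_smul, Prod.smul_mk,
          smul_zero] }
  have hD₀ : ∀ y, ‖D₀ y‖ ≤ 1 * ‖y‖ := fun y => by
    have h1 := T.le_of_opNorm_le hT (WithLp.toLp 2 ((0 : ℂ), y))
    rw [WithLp.norm_toLp_snd] at h1
    exact (WithLp.norm_snd_le _ _).trans h1
  let D : E →L[ℂ] E := D₀.mkContinuous 1 hD₀
  have hD : ‖D‖ ≤ 1 := LinearMap.mkContinuous_norm_le _ zero_le_one _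
  let c : E := (T (WithLp.toLp 2 (1, 0))).snd
  have hsnd : ∀ y : E, (T (WithLp.toLp 2 (1, y))).snd = c + D y := fun y => by
    have : WithLp.toLp 2 ((1 : ℂ), y) = WithLp.toLp 2 (1, 0) + WithLp.toLp 2 (0, y) := by
      rw [← WithLp.toLp_add, Prod.mk_add_mk, add_zero, zero_add]
    rw [this, map_add, WithLp.add_snd]
    rfl
  obtain ⟨u, hu⟩ := isUnit_one_sub_smul hD (c := conj (z : ℂ)) (by simpa using z.norm_lt_one)
  have heq : ∀ y : E, (u : E →L[ℂ] E) y = y - conj (z : ℂ) • D y := fun y => by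
    rw [hu]
    simp
  have hinv : ∀ y : E, (u : E →L[ℂ] E) ((↑u⁻¹ : E →L[ℂ] E) y) = y := fun y =>
    congrArg (fun S : E →L[ℂ] E => S y) u.mul_inv
  have hinv' : ∀ y : E, (↑u⁻¹ : E →L[ℂ] E) ((u : E →L[ℂ] E) y) = y := fun y =>
    congrArg (fun S : E →L[ℂ] E => S y) u.inv_mul
  set h : E := (↑u⁻¹ : E →L[ℂ] E) c with hh
  refine ⟨conj (T (WithLp.toLp 2 (1, conj (z : ℂ) • h))).fst, h, ?_, fun w' h' H => ?_⟩
  · have e := hinv c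
    rw [← hh, heq] at e
    have h2 : (T (WithLp.toLp 2 (1, conj (z : ℂ) • h))).snd = h := by
      rw [hsnd, map_smul, ← e]
      abel
    rw [Complex.conj_conj]
    exact congrArg (fun y => WithLp.toLp 2 ((T (WithLp.toLp 2 (1, conj (z : ℂ) • h))).fst, y)) h2
  · have h2 : c + D (conj (z : ℂ) • h') = h' := by
      rw [← hsnd, H]
      rfl
    have h3 : h' = h := by
      rw [hh, ← hinv' h', heq]
      congr 1
      rw [map_smul] at h2
      nth_rewrite 1 [← h2]
      abel
    rw [← h3, H]
    exact (Complex.conj_conj w').symm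

/-- Contractive multipliers of `H_A` are restrictions of contractive multipliers of `H²`. -/
theorem exists_extension_of_norm_le_one {A : Set 𝔻} (f : multipliers A)
    (hf : multiplierNorm f ≤ 1) :
    ∃ F : multiplierAlgebra HardySpace, multiplierNorm F ≤ 1 ∧
      ∀ a : A, (F : 𝔻 → ℂ) a = (f : A → ℂ) a := by
  let E := subspaceOf HardySpace A
  let M : E →L[ℂ] E := mulOp f
  have hM : ‖M‖ ≤ 1 := hf
  obtain ⟨S, hS⟩ := exists_inner_map_map_eq_sub hM
  let h : A → E := fun a => S (kernelAt E a)
  have hk : ∀ a b : A, inner ℂ (kernelAt E a) (kernelAt E b) =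
      (1 - (a : 𝔻) * conj ((b : 𝔻) : ℂ))⁻¹ := fun a b => by
      rw [Submodule.coe_inner, coe_kernelAt_subspaceOf, coe_kernelAt_subspaceOf,
        inner_kernelAt_kernelAt]
  have hh : ∀ a b : A, inner ℂ (h a) (h b) =
      (1 - (f : A → ℂ) a * conj ((f : A → ℂ) b)) * (1 - (a : 𝔻) * conj ((b : 𝔻) : ℂ))⁻¹ :=
    fun a b => by
      rw [hS, adjoint_mulOp_kernelAt, adjoint_mulOp_kernelAt, inner_smul_left, inner_smul_right,
        Complex.conj_conj, hk]
      ring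
  -- The lurking isometry: `(1 - a b̄) ⟨h_a, h_b⟩ = 1 - f a conj (f b)`, rearranged so that each
  -- side is a Gram matrix.
  have hgram := norm_sum_eq_of_inner_eq
    (u := fun a : A => WithLp.toLp 2 ((1 : ℂ), conj ((a : 𝔻) : ℂ) • h a))
    (v := fun a : A => WithLp.toLp 2 (conj ((f : A → ℂ) a), h a)) (fun a b => by
      simp only [WithLp.prod_inner_apply, inner_smul_left, inner_smul_right, hh]
      simp only [RCLike.inner_apply, map_one, Complex.conj_conj]
      linear_combination (-(1 - (f : A → ℂ) a * conj ((f : A → ℂ) b))) *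
        mul_inv_cancel₀ (one_sub_mul_conj_ne_zero (a : 𝔻) b))
  obtain ⟨T, hT, hTu⟩ := exists_clm_of_norm_sum_le zero_le_one
    (fun s a => ((hgram s a).symm.le.trans_eq (one_mul _).symm))
  choose F g hFg hu using exists_colligation_solution hT
  obtain ⟨hF, hn⟩ := exists_mem_multiplierAlgebra_of_contraction hT hFg
  -- At `a ∈ A` the pair `(f a, h a)` solves the equation defining `F a`, so uniqueness gives `F a =
  -- f a`.
  exact ⟨⟨F, hF⟩, hn, fun a => (hu a _ _ (hTu a)).symm⟩

theorem exists_extension {A : Set 𝔻} (f : multipliers A) :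
    ∃ F : multiplierAlgebra HardySpace, ∀ a : A, (F : 𝔻 → ℂ) a = (f : A → ℂ) a := by
  -- The summand `1` keeps the scaling factor nonzero when `f` has norm zero.
  set r : ℝ := multiplierNorm f + 1 with hr
  have hr0 : 0 < r := by
    have := multiplierNorm_nonneg f
    positivity
  obtain ⟨F, -, hF⟩ := exists_extension_of_norm_le_one ((r⁻¹ : ℂ) • f) (by
    refine (multiplierNorm_smul_le _ f).trans ?_
    rw [norm_inv, Complex.norm_real, Real.norm_of_nonneg hr0.le, inv_mul_le_one₀ hr0]
    linarith)
  refine ⟨(r : ℂ) • F, fun a => ?_⟩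
  have hrc : (r : ℂ) ≠ 0 := by exact_mod_cast hr0.ne'
  have := hF a
  simp only [Subalgebra.coe_smul, Pi.smul_apply, smul_eq_mul] at this ⊢
  rw [this, mul_inv_cancel_left₀ hrc]

/-- If a point is not in the kernel hull of `A`, some multiplier of `H²` separates it from `A`. -/
theorem mem_kernelHull_of_multiplier {A : Set 𝔻} {x : 𝔻}
    (h : ∀ F : multiplierAlgebra HardySpace, (∀ a ∈ A, (F : 𝔻 → ℂ) a = 0) → (F : 𝔻 → ℂ) x = 0) :
    x ∈ kernelHull HardySpace A := by
  classical
  by_contra hx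
  let P := subspaceOf HardySpace A
  -- The part of `k_x` orthogonal to `H_A` vanishes on `A`, and `e x = ‖e‖²` is nonzero.
  let e : HardySpace := kernelAt HardySpace x - P.starProjection (kernelAt HardySpace x)
  have he0 : e ∈ Pᗮ := P.sub_starProjection_mem_orthogonal _
  have he : ∀ a ∈ A, e a = 0 := fun a ha => by
    rw [← inner_kernelAt]
    exact he0 _ (kernelAt_mem_subspaceOf ha)
  have hex : e x ≠ 0 := fun h0 => by
    refine hx (?_ : kernelAt HardySpace x ∈ P)
    have h1 : inner ℂ e e = 0 := by
      conv_lhs => enter [2]; change kernelAt HardySpace x - P.starProjection (kernelAt HardySpace x)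
      rw [inner_sub_left, inner_kernelAt, h0, he0 _ (P.starProjection_apply_mem _), sub_zero]
    have h2 : e = 0 := inner_self_eq_zero.mp h1
    rw [sub_eq_zero.mp h2]
    exact P.starProjection_apply_mem _
  let B : Set 𝔻 := insert x A
  have hPB : P ≤ subspaceOf HardySpace B :=
    Submodule.topologicalClosure_mono (Submodule.span_mono (Set.image_mono (Set.subset_insert x A)))
  have heB : e ∈ subspaceOf HardySpace B :=
    Submodule.sub_mem _ (kernelAt_mem_subspaceOf (Set.mem_insert x A))
      (hPB (P.starProjection_apply_mem _))
  -- The indicator of `x` multiplies `H_B` into the line spanned by `e`; its extension to the disk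
  -- is the separating multiplier.
  have hmem : (fun b : B => if (b : 𝔻) = x then (1 : ℂ) else 0) ∈ multipliers B := fun g => by
    refine ⟨((e x)⁻¹ * (g : HardySpace) x) • ⟨e, heB⟩, fun b => ?_⟩
    rw [subspaceOf_apply, subspaceOf_apply, Submodule.coe_smul, coe_smul, Pi.smul_apply,
      smul_eq_mul]
    by_cases hb : (b : 𝔻) = x
    · simp only [hb, if_true]
      field_simp
    · simp [hb, he b (b.2.resolve_left hb)]
  obtain ⟨F, hF⟩ := exists_extension ⟨_, hmem⟩
  have h1 := hF ⟨x, Set.mem_insert x A⟩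
  have h2 := h F fun a ha => by
    have hne : a ≠ x := fun h => hx (h ▸ kernelAt_mem_subspaceOf ha)
    have := hF ⟨a, Set.mem_insert_of_mem x ha⟩
    simpa [hne] using this
  rw [h2] at h1
  simp at h1

end HardySpace

/-! ### Automorphisms of the disk -/

namespace HardySpace

open RKHS

theorem HolomorphicSelfMap.comp {f g : 𝔻 → 𝔻} (hf : HolomorphicSelfMap f)
    (hg : HolomorphicSelfMap g) : HolomorphicSelfMap (f ∘ g) := by
  obtain ⟨F, hF, hFf⟩ := hf
  obtain ⟨G, hG, hGg⟩ := hg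
  refine ⟨F ∘ G, hF.comp hG fun z hz => ?_, fun z => ?_⟩
  · have hz' : ‖z‖ < 1 := by simpa using hz
    have := hGg (.mk z hz')
    rw [Complex.UnitDisc.coe_mk] at this
    rw [this]
    simpa using (g (.mk z hz')).norm_lt_one
  · rw [Function.comp_apply, hGg, hFf, Function.comp_apply]

theorem HolomorphicSelfMap.id : HolomorphicSelfMap id :=
  ⟨fun z => z, differentiableOn_id, fun _ => rfl⟩

theorem IsDiskAutomorphism.symm {σ : 𝔻 ≃ 𝔻} (h : IsDiskAutomorphism σ) :
    IsDiskAutomorphism σ.symm :=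
  ⟨h.2, h.1⟩

theorem IsDiskAutomorphism.trans {σ τ : 𝔻 ≃ 𝔻} (hσ : IsDiskAutomorphism σ)
    (hτ : IsDiskAutomorphism τ) : IsDiskAutomorphism (σ.trans τ) :=
  ⟨hτ.1.comp hσ.1, hσ.2.comp hτ.2⟩

/-- The involution `z ↦ (a - z) / (1 - ā z)`, as a function. -/
noncomputable def moebiusFun (a : 𝔻) (z : ℂ) : ℂ := (a - z) / (1 - z * conj (a : ℂ))

/-- On the diagonal this identity shows that the disk is preserved; off the diagonal it is the
transformation law of the Szegő kernel. -/
theorem one_sub_moebiusFun_mul_conj (a z w : 𝔻) :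
    1 - moebiusFun a z * conj (moebiusFun a w) =
      (1 - a * conj (a : ℂ)) * (1 - z * conj (w : ℂ)) /
        ((1 - z * conj (a : ℂ)) * (1 - a * conj (w : ℂ))) := by
  have h1 := one_sub_mul_conj_ne_zero z a
  have h2 := one_sub_mul_conj_ne_zero a w
  have h3 : conj (moebiusFun a w) = (conj (a : ℂ) - conj (w : ℂ)) / (1 - a * conj (w : ℂ)) := by
    simp [moebiusFun, mul_comm]
  rw [h3, moebiusFun, div_mul_div_comm, eq_div_iff (mul_ne_zero h1 h2), sub_mul,
    div_mul_cancel₀ _ (mul_ne_zero h1 h2)]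
  ring

theorem norm_moebiusFun_lt_one (a z : 𝔻) : ‖moebiusFun a z‖ < 1 := by
  have h := one_sub_moebiusFun_mul_conj a z z
  have h1 := one_sub_mul_conj_ne_zero z a
  have e1 : ((1 - z * conj (a : ℂ)) * (1 - a * conj (z : ℂ)) : ℂ) =
      ((‖1 - z * conj (a : ℂ)‖ ^ 2 : ℝ) : ℂ) := by
    rw [← Complex.normSq_eq_norm_sq, ← Complex.mul_conj]
    simp [mul_comm]
  rw [e1, Complex.mul_conj, Complex.mul_conj, Complex.mul_conj, Complex.normSq_eq_norm_sq,
    Complex.normSq_eq_norm_sq, Complex.normSq_eq_norm_sq] at h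
  have h' : 1 - ‖moebiusFun a z‖ ^ 2 =
      (1 - ‖(a : ℂ)‖ ^ 2) * (1 - ‖(z : ℂ)‖ ^ 2) / ‖1 - z * conj (a : ℂ)‖ ^ 2 := by
    exact_mod_cast h
  have hpos : 0 < 1 - ‖moebiusFun a z‖ ^ 2 := by
    rw [h']
    have := norm_pos_iff.mpr h1
    have := a.sq_norm_lt_one
    have := z.sq_norm_lt_one
    exact div_pos (mul_pos (by linarith) (by linarith)) (by positivity)
  nlinarith [norm_nonneg (moebiusFun a z)]

theorem moebiusFun_moebiusFun (a z : 𝔻) : moebiusFun a (moebiusFun a z) = z := by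
  have h1 := one_sub_mul_conj_ne_zero z a
  have h2 := one_sub_mul_conj_ne_zero a a
  have e1 : (a : ℂ) - moebiusFun a z =
      z * (1 - a * conj (a : ℂ)) / (1 - z * conj (a : ℂ)) := by
    rw [moebiusFun, eq_div_iff h1, sub_mul, div_mul_cancel₀ _ h1]
    ring
  have e2 : 1 - moebiusFun a z * conj (a : ℂ) =
      (1 - a * conj (a : ℂ)) / (1 - z * conj (a : ℂ)) := by
    rw [moebiusFun, eq_div_iff h1, sub_mul, div_mul_eq_mul_div, div_mul_cancel₀ _ h1]
    ring
  rw [moebiusFun, e1, e2, div_div_div_cancel_right₀ h1, mul_div_cancel_right₀ _ h2]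

/-- The involutive automorphism of the disk that exchanges `a` and `0`. -/
noncomputable def moebius (a : 𝔻) : 𝔻 ≃ 𝔻 :=
  Function.Involutive.toPerm (fun z => .mk (moebiusFun a z) (norm_moebiusFun_lt_one a z))
    fun z => Complex.UnitDisc.coe_injective (moebiusFun_moebiusFun a z)

theorem coe_moebius (a z : 𝔻) : (moebius a z : ℂ) = moebiusFun a z := rfl

theorem moebius_moebius (a z : 𝔻) : moebius a (moebius a z) = z := (moebius a).left_inv z

theorem moebius_self (a : 𝔻) : moebius a a = 0 :=
  Complex.UnitDisc.coe_injective (by simp [coe_moebius, moebiusFun])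

theorem moebius_zero (a : 𝔻) : moebius a 0 = a :=
  Complex.UnitDisc.coe_injective (by simp [coe_moebius, moebiusFun])

theorem holomorphicSelfMap_moebius (a : 𝔻) : HolomorphicSelfMap (moebius a) := by
  refine ⟨moebiusFun a, ?_, fun z => rfl⟩
  refine DifferentiableOn.div (by fun_prop) (by fun_prop) fun z hz => ?_
  exact one_sub_mul_conj_ne_zero (.mk z (by simpa using hz)) a

theorem isDiskAutomorphism_moebius (a : 𝔻) : IsDiskAutomorphism (moebius a) :=
  ⟨holomorphicSelfMap_moebius a, holomorphicSelfMap_moebius a⟩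

theorem HolomorphicSelfMap.norm_le {f : 𝔻 → 𝔻} (hf : HolomorphicSelfMap f) (h0 : f 0 = 0)
    (z : 𝔻) : ‖(f z : ℂ)‖ ≤ ‖(z : ℂ)‖ := by
  obtain ⟨g, hg, hgf⟩ := hf
  have hm : Set.MapsTo g (Metric.ball 0 1) (Metric.closedBall 0 1) := fun w hw => by
    have hw' : ‖w‖ < 1 := by simpa using hw
    have := hgf (.mk w hw')
    rw [Complex.UnitDisc.coe_mk] at this
    rw [this]
    simpa using (f (.mk w hw')).norm_lt_one.le
  have hg0 : g 0 = 0 := by simpa [h0] using hgf 0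
  rw [← hgf]
  exact Complex.norm_le_norm_of_mapsTo_ball hg hm hg0 z.norm_lt_one

/-- The equality case of the Schwarz lemma. -/
theorem HolomorphicSelfMap.exists_eq_mul {f : 𝔻 → 𝔻} (hf : HolomorphicSelfMap f) (h0 : f 0 = 0)
    {z₀ : 𝔻} (hz₀ : z₀ ≠ 0) (hn : ‖(f z₀ : ℂ)‖ = ‖(z₀ : ℂ)‖) :
    ∃ c : ℂ, ‖c‖ = 1 ∧ ∀ z : 𝔻, (f z : ℂ) = c * z := by
  obtain ⟨g, hg, hgf⟩ := hf
  have hm : Set.MapsTo g (Metric.ball 0 1) (Metric.closedBall 0 1) := fun w hw => by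
    have hw' : ‖w‖ < 1 := by simpa using hw
    have := hgf (.mk w hw')
    rw [Complex.UnitDisc.coe_mk] at this
    rw [this]
    simpa using (f (.mk w hw')).norm_lt_one.le
  have hg0 : g 0 = 0 := by simpa [h0] using hgf 0
  have hz : (z₀ : ℂ) ≠ 0 := by simpa using hz₀
  obtain ⟨c, hc, he⟩ := Complex.affine_of_mapsTo_ball_of_exists_norm_dslope_eq_div' hg
    (by rwa [hg0]) ⟨z₀, by simpa using z₀.norm_lt_one, by
      rw [dslope_of_ne _ hz, slope_def_field, hg0, sub_zero, sub_zero, norm_div, hgf, hn,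
        div_self (norm_ne_zero_iff.mpr hz), div_one]⟩
  refine ⟨c, by simpa using hc, fun z => ?_⟩
  rw [← hgf, he (by simpa using z.norm_lt_one), hg0]
  simp [mul_comm]

/-- A holomorphic self-map of the disk with two fixed points is the identity. -/
theorem HolomorphicSelfMap.eq_of_two_fixed {f : 𝔻 → 𝔻} (hf : HolomorphicSelfMap f) {a b : 𝔻}
    (hab : a ≠ b) (ha : f a = a) (hb : f b = b) (z : 𝔻) : f z = z := by
  -- Conjugation moves the fixed point `a` to `0`; the other fixed point is then an equality case of
  -- the Schwarz lemma.
  have hg : HolomorphicSelfMap (moebius a ∘ f ∘ moebius a) :=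
    (holomorphicSelfMap_moebius a).comp (hf.comp (holomorphicSelfMap_moebius a))
  have hg0 : (moebius a ∘ f ∘ moebius a) 0 = 0 := by
    simp [moebius_zero, ha, moebius_self]
  have hb0 : moebius a b ≠ 0 := fun h => hab ((moebius a).injective (by rw [h, moebius_self]))
  have hgb : (moebius a ∘ f ∘ moebius a) (moebius a b) = moebius a b := by
    simp [moebius_moebius, hb]
  obtain ⟨c, -, hc⟩ := hg.exists_eq_mul hg0 hb0 (by rw [hgb])
  have hc1 : c = 1 := by
    have h1 := hc (moebius a b)
    rw [hgb] at h1
    exact mul_right_cancel₀ (b := (moebius a b : ℂ)) (by simpa using hb0)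
      (by rw [one_mul]; exact h1.symm)
  have h2 := hc (moebius a z)
  rw [hc1, one_mul, Complex.UnitDisc.coe_inj] at h2
  simp only [Function.comp_apply, moebius_moebius] at h2
  exact (moebius a).injective h2

/-- Automorphisms of the disk rescale the Szegő kernel. -/
theorem IsDiskAutomorphism.exists_inner_kernelAt {σ : 𝔻 ≃ 𝔻} (hσ : IsDiskAutomorphism σ) :
    ∃ d : 𝔻 → ℂ, (∀ z, d z ≠ 0) ∧ ∀ z w,
      inner ℂ (kernelAt HardySpace (σ z)) (kernelAt HardySpace (σ w)) =
        inner ℂ (d z • kernelAt HardySpace z) (d w • kernelAt HardySpace w) := by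
  set a := σ 0 with ha
  have hτ : IsDiskAutomorphism (σ.trans (moebius a)) := hσ.trans (isDiskAutomorphism_moebius a)
  set τ := σ.trans (moebius a) with hτdef
  have hτ0 : τ 0 = 0 := by simp [hτdef, ← ha, moebius_self]
  have hτ0' : τ.symm 0 = 0 := by rw [Equiv.symm_apply_eq, hτ0]
  obtain ⟨z₀, hz₀⟩ : ∃ z₀ : 𝔻, z₀ ≠ 0 :=
    ⟨.mk (1 / 2) (by norm_num), by simp⟩
  -- The Schwarz lemma for `τ` and for its inverse; hence `τ` is a rotation and leaves `z w̄`
  -- unchanged.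
  have hn : ‖(τ z₀ : ℂ)‖ = ‖(z₀ : ℂ)‖ := by
    refine le_antisymm (hτ.1.norm_le hτ0 z₀) ?_
    simpa using hτ.2.norm_le hτ0' (τ z₀)
  obtain ⟨c, hc, hcz⟩ := hτ.1.exists_eq_mul hτ0 hz₀ hn
  have hσz : ∀ z, σ z = moebius a (τ z) := fun z => by simp [hτdef, moebius_moebius]
  have hcc : c * conj c = 1 := by
    rw [Complex.mul_conj, Complex.normSq_eq_norm_sq, hc]
    simp
  have hr : (0 : ℝ) < 1 - ‖(a : ℂ)‖ ^ 2 := by linarith [a.sq_norm_lt_one]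
  set r : ℝ := √(1 - ‖(a : ℂ)‖ ^ 2) with hrdef
  have hr0 : (r : ℂ) ≠ 0 := by exact_mod_cast (Real.sqrt_pos.mpr hr).ne'
  have hrr : (1 - a * conj (a : ℂ) : ℂ) = r * r := by
    rw [Complex.mul_conj, Complex.normSq_eq_norm_sq, ← Complex.ofReal_mul,
      Real.mul_self_sqrt hr.le]
    push_cast
    rfl
  refine ⟨fun z => (1 - a * conj (τ z : ℂ)) / r, fun z =>
    div_ne_zero (one_sub_mul_conj_ne_zero a (τ z)) hr0, fun z w => ?_⟩
  have h3 : (τ z : ℂ) * conj (τ w : ℂ) = z * conj (w : ℂ) := by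
    rw [hcz, hcz, map_mul]
    linear_combination (z : ℂ) * conj (w : ℂ) * hcc
  have h4 : conj ((1 - a * conj (τ z : ℂ)) / (r : ℂ)) = (1 - τ z * conj (a : ℂ)) / r := by
    simp [mul_comm]
  rw [inner_smul_left, inner_smul_right, inner_kernelAt_kernelAt, inner_kernelAt_kernelAt, hσz,
    hσz, coe_moebius, coe_moebius, one_sub_moebiusFun_mul_conj, h3, hrr, h4, inv_div]
  beta_reduce
  have h5 := one_sub_mul_conj_ne_zero z w
  generalize (1 - z * conj (w : ℂ) : ℂ) = q at h5 ⊢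
  field_simp

end HardySpace

/-! ### Isomorphisms of multiplier algebras -/

namespace HardySpace

open RKHS

/-- Automorphisms of the disk pull multipliers back, without increasing norms. -/
theorem IsDiskAutomorphism.exists_comp_mem_multipliers {σ : 𝔻 ≃ 𝔻} (hσ : IsDiskAutomorphism σ)
    {A B : Set 𝔻} (h : ∀ a : A, σ a ∈ B) (f : multipliers B) :
    ∃ hf : (fun a : A => (f : B → ℂ) ⟨σ a, h a⟩) ∈ multipliers A,
      multiplierNorm ⟨_, hf⟩ ≤ multiplierNorm f := by
  obtain ⟨d, hd, hk⟩ := hσ.exists_inner_kernelAt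
  refine exists_mem_multiplierAlgebra (multiplierNorm_nonneg f) fun s a => ?_
  -- The rescaling `d` is absorbed into the coefficients and commutes with the diagonal action of
  -- `conj f`.
  have hgram : ∀ b : A → ℂ, ‖∑ x ∈ s, b x • kernelAt (subspaceOf HardySpace A) x‖ =
      ‖∑ x ∈ s, (b x / d x) • kernelAt (subspaceOf HardySpace B) ⟨σ x, h x⟩‖ := fun b => by
    rw [norm_sum_smul_kernelAt_subspaceOf (fun x => x),
      norm_sum_smul_kernelAt_subspaceOf (fun x : A => ⟨σ x, h x⟩),
      norm_sum_eq_of_inner_eq (v := fun x : A => d x • kernelAt HardySpace (x : 𝔻))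
        fun x y => hk x y]
    simp only [smul_smul, div_mul_cancel₀ _ (hd _)]
  have := norm_sum_conj_smul_kernelAt_le f (fun x : A => (⟨σ x, h x⟩ : B)) s
    fun x => a x / d x
  simp only [smul_smul] at this ⊢
  rw [hgram, hgram]
  simpa only [div_mul_eq_mul_div] using this

/-- Congruent sets have isometrically isomorphic multiplier algebras. -/
theorem Congruent.exists_isIsometric {A B : Set 𝔻} (h : Congruent A B) :
    ∃ Φ : multipliers A ≃ₐ[ℂ] multipliers B, IsIsometric Φ := by
  obtain ⟨σ, hσ, rfl⟩ := h
  have h₁ : ∀ a : A, σ a ∈ σ '' A := fun a => ⟨a, a.2, rfl⟩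
  have h₂ : ∀ b : σ '' A, σ.symm b ∈ A := by
    rintro ⟨_, a, ha, rfl⟩
    simpa using ha
  let Φ : multipliers A ≃ₐ[ℂ] multipliers (σ '' A) :=
    { toFun := fun f => ⟨_, (hσ.symm.exists_comp_mem_multipliers h₂ f).1⟩
      invFun := fun f => ⟨_, (hσ.exists_comp_mem_multipliers h₁ f).1⟩
      left_inv := fun f => Subtype.ext (funext fun a => by simp)
      right_inv := fun f => Subtype.ext (funext fun a => by simp)
      map_mul' := fun _ _ => rfl
      map_add' := fun _ _ => rfl
      commutes' := fun _ => rfl }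
  refine ⟨Φ, fun f => le_antisymm (hσ.symm.exists_comp_mem_multipliers h₂ f).2 ?_⟩
  have := (hσ.exists_comp_mem_multipliers h₁ (Φ f)).2
  have h3 : Φ.symm (Φ f) = f := Φ.symm_apply_apply f
  change multiplierNorm (Φ.symm (Φ f)) ≤ _ at this
  rwa [h3] at this

/-- Continuity at `l`; it recovers the value that is lost on dividing by `z - l`. -/
theorem eq_of_forall_ne_eq {f g : ℂ → ℂ} (hf : DifferentiableOn ℂ f (Metric.ball 0 1))
    (hg : DifferentiableOn ℂ g (Metric.ball 0 1)) {l : 𝔻}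
    (h : ∀ z : 𝔻, z ≠ l → f z = g z) : f l = g l := by
  have hl : Metric.ball (0 : ℂ) 1 ∈ 𝓝 (l : ℂ) :=
    Metric.isOpen_ball.mem_nhds (by simpa using l.norm_lt_one)
  have h1 := ((hf.differentiableAt hl).continuousAt.tendsto).mono_left
    (nhdsWithin_le_nhds (s := {(l : ℂ)}ᶜ))
  have h2 := ((hg.differentiableAt hl).continuousAt.tendsto).mono_left
    (nhdsWithin_le_nhds (s := {(l : ℂ)}ᶜ))
  refine tendsto_nhds_unique_of_eventuallyEq h1 h2 ?_
  filter_upwards [nhdsWithin_le_nhds hl, self_mem_nhdsWithin] with z hz hzl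
  have hz' : ‖z‖ < 1 := by simpa using hz
  exact h (.mk z hz') fun e => hzl (by simp [← e])

/-- Division by `z - l` among the multipliers of `H²`. -/
theorem exists_multiplier_sub_mul_eq_sub (F : multiplierAlgebra HardySpace) (l : 𝔻) :
    ∃ G : multiplierAlgebra HardySpace,
      ∀ x : 𝔻, ((x : ℂ) - l) * (G : 𝔻 → ℂ) x = (F : 𝔻 → ℂ) x - (F : 𝔻 → ℂ) l := by
  have hdiv : ∀ h : HardySpace, ∃ g : HardySpace, ∀ x : 𝔻,
      ((x : ℂ) - l) * g x = ((F : 𝔻 → ℂ) x - (F : 𝔻 → ℂ) l) * h x := fun h => by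
    obtain ⟨g, hg⟩ := exists_sub_mul_eq_sub (mulOp F h - (F : 𝔻 → ℂ) l • h) l
    refine ⟨g, fun x => ?_⟩
    rw [hg]
    simp only [coe_sub, coe_smul, Pi.sub_apply, Pi.smul_apply, mulOp_apply, smul_eq_mul]
    ring
  -- `k_0` is the constant `1`, so `G` is the quotient itself.
  obtain ⟨G, hG⟩ := hdiv (kernelAt HardySpace 0)
  simp only [kernelAt_zero_apply, mul_one] at hG
  refine ⟨⟨G, fun h => ?_⟩, hG⟩
  obtain ⟨g, hg⟩ := hdiv h
  have hne : ∀ x : 𝔻, x ≠ l → g x = G x * h x := fun x hx => by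
    have hx' : (x : ℂ) - l ≠ 0 := sub_ne_zero.mpr (by simpa using hx)
    refine mul_left_cancel₀ hx' ?_
    rw [hg, ← mul_assoc, hG]
  refine ⟨g, fun x => ?_⟩
  by_cases hx : x = l
  · subst hx
    obtain ⟨p, hp, hpg⟩ := exists_differentiableOn g
    obtain ⟨q, hq, hqG⟩ := exists_differentiableOn G
    obtain ⟨r, hr, hrh⟩ := exists_differentiableOn h
    have := eq_of_forall_ne_eq hp (hq.mul hr) (l := x) fun z hz => by
      rw [Pi.mul_apply, hpg, hqG, hrh, hne z hz]
    rwa [Pi.mul_apply, hpg, hqG, hrh] at this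
  · exact hne x hx

/-- The restriction of multipliers of `H²` to `A`. -/
noncomputable def restrict (A : Set 𝔻) (F : multiplierAlgebra HardySpace) : multipliers A :=
  ⟨_, (exists_restrict_mem_multiplierAlgebra A F).1⟩

theorem multiplierNorm_restrict_le (A : Set 𝔻) (F : multiplierAlgebra HardySpace) :
    multiplierNorm (restrict A F) ≤ multiplierNorm F :=
  (exists_restrict_mem_multiplierAlgebra A F).2

theorem nonempty_of_algEquiv {A B : Set 𝔻} (Φ : multipliers A ≃ₐ[ℂ] multipliers B)
    (hB : B.Nonempty) : A.Nonempty := by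
  by_contra hA
  obtain ⟨b, hb⟩ := hB
  have h10 : (1 : multipliers A) = 0 := Subtype.ext (funext fun a => (hA ⟨a, a.2⟩).elim)
  have h := congrArg (fun f : multipliers B => (f : B → ℂ) ⟨b, hb⟩) (congrArg Φ h10)
  simp at h

/-- An isometric isomorphism is composition with a holomorphic self-map of the disk. -/
theorem IsIsometric.exists_holomorphicSelfMap {A B : Set 𝔻}
    (hA : kernelHull HardySpace A = A) (hB : B.Nonempty) {Φ : multipliers A ≃ₐ[ℂ] multipliers B}
    (hΦ : IsIsometric Φ) :
    ∃ F : 𝔻 → 𝔻, HolomorphicSelfMap F ∧ ∀ b : B, ∃ h : F b ∈ A, ∀ f : multipliers A,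
      (Φ f : B → ℂ) b = (f : A → ℂ) ⟨F b, h⟩ := by
  obtain ⟨F, hF, hFΦ⟩ := exists_extension_of_norm_le_one (Φ (restrict A coord))
    ((hΦ _).trans_le ((multiplierNorm_restrict_le A coord).trans multiplierNorm_coord_le))
  have hF1 : ∀ z, ‖(F : 𝔻 → ℂ) z‖ ≤ 1 := fun z =>
    (norm_le_multiplierNorm F (kernelAt_ne_zero z)).trans hF
  obtain ⟨g, hg, hgF⟩ := exists_differentiableOn_multiplier F
  -- If `|F|` reached `1`, `F` would be constant, and by injectivity of `Φ` the coordinate function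
  -- on the nonempty set `A` would be a constant of modulus at least `1`.
  have hlt : ∀ z, ‖(F : 𝔻 → ℂ) z‖ < 1 := by
    by_contra! hz
    obtain ⟨z, hz⟩ := hz
    have hmax : IsMaxOn (norm ∘ g) (Metric.ball 0 1) (z : ℂ) := fun w hw => by
      have hw' : ‖w‖ < 1 := by simpa using hw
      have h1 := hgF (.mk w hw')
      rw [Complex.UnitDisc.coe_mk] at h1
      simp only [Set.mem_ofPred_eq, Function.comp_apply, h1, hgF]
      exact (hF1 _).trans hz
    have hconst := Complex.eqOn_of_isPreconnected_of_isMaxOn_norm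
      (convex_ball (0 : ℂ) 1).isPreconnected Metric.isOpen_ball hg
      (by simpa using z.norm_lt_one) hmax
    have hFc : ∀ w, (F : 𝔻 → ℂ) w = (F : 𝔻 → ℂ) z := fun w => by
      rw [← hgF, ← hgF, hconst (by simpa using w.norm_lt_one), Function.const_apply]
    have hΦc : Φ (restrict A coord) = algebraMap ℂ _ ((F : 𝔻 → ℂ) z) :=
      Subtype.ext (funext fun b => by rw [← hFΦ, hFc]; rfl)
    rw [← Φ.commutes] at hΦc
    have hc := Φ.injective hΦc
    obtain ⟨a, ha⟩ := nonempty_of_algEquiv Φ hB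
    have h1 : (a : ℂ) = (F : 𝔻 → ℂ) z :=
      congrArg (fun f : multipliers A => (f : A → ℂ) ⟨a, ha⟩) hc
    rw [← h1] at hz
    exact absurd a.norm_lt_one hz.not_gt
  -- `Φ` followed by evaluation at `b` is a character sending `z - l` to `0` for `l = F b`; it
  -- therefore kills `G - G l = (z - l) Q`.
  have hval : ∀ (b : B) (G : multiplierAlgebra HardySpace),
      (Φ (restrict A G) : B → ℂ) b = (G : 𝔻 → ℂ) (.mk _ (hlt b)) := fun b G => by
    set l : 𝔻 := .mk _ (hlt b) with hl
    obtain ⟨Q, hQ⟩ := exists_multiplier_sub_mul_eq_sub G l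
    have e : (restrict A coord - algebraMap ℂ _ (l : ℂ)) * restrict A Q =
        restrict A G - algebraMap ℂ _ ((G : 𝔻 → ℂ) l) := Subtype.ext (funext fun a => hQ a)
    have e2 := congrArg (fun f : multipliers B => (f : B → ℂ) b) (congrArg Φ e)
    rw [map_mul, map_sub, map_sub, Φ.commutes, Φ.commutes] at e2
    change ((Φ (restrict A coord) : B → ℂ) b - l) * (Φ (restrict A Q) : B → ℂ) b =
      (Φ (restrict A G) : B → ℂ) b - (G : 𝔻 → ℂ) l at e2
    rw [← hFΦ, hl, Complex.UnitDisc.coe_mk, sub_self, zero_mul] at e2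
    exact sub_eq_zero.mp e2.symm
  -- A multiplier vanishing on `A` restricts to `0`, so by `hval` it vanishes at `F b`: this is
  -- where `S(A) = A` enters.
  have hmem : ∀ b : B, Complex.UnitDisc.mk _ (hlt b) ∈ A := fun b => by
    rw [← hA]
    refine mem_kernelHull_of_multiplier fun G hG => ?_
    have h0 : restrict A G = 0 := Subtype.ext (funext fun a => hG a a.2)
    rw [← hval, h0, map_zero]
    rfl
  refine ⟨fun z => .mk _ (hlt z), ⟨g, hg, hgF⟩, fun b => ⟨hmem b, fun f => ?_⟩⟩
  obtain ⟨G, hG⟩ := exists_extension f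
  have hGf : restrict A G = f := Subtype.ext (funext hG)
  rw [← hG, ← hval, hGf]

/-- An isometric isomorphism is composition with an automorphism of the disk. -/
theorem IsIsometric.exists_isDiskAutomorphism {A B : Set 𝔻}
    (hA : kernelHull HardySpace A = A) (hB : kernelHull HardySpace B = B)
    {Φ : multipliers A ≃ₐ[ℂ] multipliers B} (hΦ : IsIsometric Φ) :
    ∃ σ : 𝔻 ≃ 𝔻, IsDiskAutomorphism σ ∧ σ.symm '' A = B ∧ ∀ b : B, ∃ h : σ b ∈ A,
      ∀ f : multipliers A, (Φ f : B → ℂ) b = (f : A → ℂ) ⟨σ b, h⟩ := by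
  rcases B.eq_empty_or_nonempty with rfl | hBne
  · have hAe : A = ∅ := by
      by_contra h
      exact Set.not_nonempty_empty
        (nonempty_of_algEquiv Φ.symm (Set.nonempty_iff_ne_empty.mpr h))
    exact ⟨Equiv.refl _, ⟨HolomorphicSelfMap.id, HolomorphicSelfMap.id⟩, by simp [hAe],
      fun b => b.2.elim⟩
  have hΦ' : IsIsometric Φ.symm := fun f => by
    rw [← hΦ, AlgEquiv.apply_symm_apply]
  obtain ⟨F, hF, hFΦ⟩ := hΦ.exists_holomorphicSelfMap hA hBne
  obtain ⟨G, hG, hGΦ⟩ := hΦ'.exists_holomorphicSelfMap hB (nonempty_of_algEquiv Φ hBne)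
  -- Apply `Φ ∘ Φ⁻¹ = id` to the coordinate function, which separates points.
  have hGF : ∀ b ∈ B, G (F b) = b := fun b hb => by
    obtain ⟨h1, h2⟩ := hFΦ ⟨b, hb⟩
    obtain ⟨h3, h4⟩ := hGΦ ⟨F b, h1⟩
    have := h2 (Φ.symm (restrict B coord))
    rw [h4, AlgEquiv.apply_symm_apply] at this
    exact Complex.UnitDisc.coe_injective this.symm
  have hFG : ∀ a ∈ A, F (G a) = a := fun a ha => by
    obtain ⟨h1, h2⟩ := hGΦ ⟨a, ha⟩
    obtain ⟨h3, h4⟩ := hFΦ ⟨G a, h1⟩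
    have := h2 (Φ (restrict A coord))
    rw [h4, AlgEquiv.symm_apply_apply] at this
    exact Complex.UnitDisc.coe_injective this.symm
  obtain ⟨σ, hσ, hσF⟩ : ∃ σ : 𝔻 ≃ 𝔻, IsDiskAutomorphism σ ∧ ∀ b ∈ B, σ b = F b := by
    -- A single fixed point of `G ∘ F` does not force `F` to be bijective, so for a one-point `B` an
    -- automorphism carrying `b` through `0` to `F b` is used instead.
    rcases B.subsingleton_or_nontrivial with hs | ⟨b₁, hb₁, b₂, hb₂, hne⟩
    · obtain ⟨b, hb⟩ := hBne
      refine ⟨(moebius b).trans (moebius (F b)),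
        (isDiskAutomorphism_moebius _).trans (isDiskAutomorphism_moebius _), fun c hc => ?_⟩
      rw [hs hc hb, Equiv.trans_apply, moebius_self, moebius_zero]
    · have hneF : F b₁ ≠ F b₂ := fun h => hne (by rw [← hGF b₁ hb₁, h, hGF b₂ hb₂])
      refine ⟨⟨F, G, (hG.comp hF).eq_of_two_fixed hne (hGF b₁ hb₁) (hGF b₂ hb₂),
        (hF.comp hG).eq_of_two_fixed hneF ?_ ?_⟩, ⟨hF, hG⟩, fun _ _ => rfl⟩
      · exact hFG _ (hFΦ ⟨b₁, hb₁⟩).1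
      · exact hFG _ (hFΦ ⟨b₂, hb₂⟩).1
  refine ⟨σ, hσ, ?_, fun b => ?_⟩
  · ext b
    constructor
    · rintro ⟨a, ha, rfl⟩
      obtain ⟨h1, -⟩ := hGΦ ⟨a, ha⟩
      have : σ (G a) = a := (hσF _ h1).trans (hFG a ha)
      rwa [(Equiv.symm_apply_eq σ).mpr this.symm]
    · intro hb
      exact ⟨σ b, by rw [hσF b hb]; exact (hFΦ ⟨b, hb⟩).1, σ.symm_apply_apply b⟩
  · obtain ⟨h1, h2⟩ := hFΦ b
    have e := hσF b b.2
    refine ⟨e ▸ h1, fun f => ?_⟩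
    rw [h2]
    exact congrArg (f : A → ℂ) (Subtype.ext e.symm)

end HardySpace

theorem theorem1p6 (A B : Set Complex.UnitDisc)
    (hA : RKHS.kernelHull HardySpace A = A) (hB : RKHS.kernelHull HardySpace B = B) :
    ((∃ Φ : HardySpace.multipliers A ≃ₐ[ℂ] HardySpace.multipliers B, HardySpace.IsIsometric Φ) ↔
      HardySpace.Congruent A B) ∧
    ∀ Φ : HardySpace.multipliers A ≃ₐ[ℂ] HardySpace.multipliers B, HardySpace.IsIsometric Φ →
      ∃ (φ : B → A) (σ : Complex.UnitDisc ≃ Complex.UnitDisc),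
        HardySpace.IsDiskAutomorphism σ ∧ (∀ b : B, (φ b : Complex.UnitDisc) = σ b) ∧
        HardySpace.IsPullback Φ φ := by
  refine ⟨⟨?_, fun h => h.exists_isIsometric⟩, fun Φ hΦ => ?_⟩
  · rintro ⟨Φ, hΦ⟩
    obtain ⟨σ, hσ, hAB, -⟩ := hΦ.exists_isDiskAutomorphism hA hB
    exact ⟨σ.symm, hσ.symm, hAB⟩
  · obtain ⟨σ, hσ, -, h⟩ := hΦ.exists_isDiskAutomorphism hA hB
    exact ⟨fun b => ⟨σ b, (h b).1⟩, σ, hσ, fun _ => rfl, fun f => funext fun b => (h b).2 f⟩
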